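/- For an integer $n\ge 2$, let $G_{\mathbb{Z}/n\mathbb{Z}}$ be the unitary Cayley graph of $\mathbb{Z}/n\mathbb{Z}$: its vertices are the elements of $\mathbb{Z}/n\mathbb{Z}$, and $x,y$ are adjacent if and only if $x-y$ is a unit. Let $\mathcal{L}(G)$ denote the line graph of a graph $G$ (its vertices are the edges of $G$, two distinct edges being adjacent if and only if they share an end-vertex), and let the energy $E(G)$ of a finite graph $G$ be the sum of the absolute values of the eigenvalues of its adjacency matrix, counted with multiplicity. Let $\varphi$ be Euler's totient function, so that $\varphi(n)=\prod_{i=1}^s p_i^{\alpha_i-1}(p_i-1)$ if $n=p_1^{\alpha_1}\cdots p_s^{\alpha_s}$ is the prime factorization of $n$. Then $$ E(\mathcal{L}(G_{\mathbb{Z}/n\mathbb{Z}}))=\begin{cases} 4, & \text{if } n=3;\\ 8, & \text{if } n=6;\\ 4\left(2^{a-1}-1\right)^2, & \text{if } n=2^{a} \text{ with } a\ge 1;\\ 4+2n\left(\varphi(n)-2\right), & \text{if } n \text{ is even and } n\neq 6;\\ 2n\left(\varphi(n)-2\right), & \text{if } n \text{ is odd and } n\neq 3. \end{cases} $$ (If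 $n$ is a power of $2$, the third and the fourth case both apply, and their values agree.) -/

import Mathlib

/-- The unitary Cayley graph of a ring `R`: the vertices are the elements of `R`, and `x`, `y` are
adjacent iff `x - y` is a unit. The clause `x ≠ y` only matters in the zero ring: if `1 ≠ 0`,
then `0` is not a unit (see `unitaryCayleyGraph_adj`). -/
def unitaryCayleyGraph (R : Type*) [Ring R] : SimpleGraph R where
  Adj x y := x ≠ y ∧ IsUnit (x - y)
  symm := ⟨fun x y h => ⟨h.1.symm, by simpa using h.2.neg⟩⟩
  loopless := ⟨fun _ h => h.1 rfl⟩

theorem unitaryCayleyGraph_adj {R : Type*} [Ring R] [Nontrivial R] (x y : R) :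
    (unitaryCayleyGraph R).Adj x y ↔ IsUnit (x - y) := by
  refine ⟨fun h => h.2, fun h => ⟨?_, h⟩⟩
  rintro rfl
  simp at h

open Classical in
/-- The energy of a finite graph: the sum of the absolute values of the eigenvalues of its
adjacency matrix, counted with multiplicity. -/
noncomputable def graphEnergy {V : Type*} [Finite V] (G : SimpleGraph V) : ℝ :=
  letI : Fintype V := Fintype.ofFinite V
  ∑ v : V, |(G.isHermitian_adjMatrix ℝ).eigenvalues v|

open Polynomial in
theorem sum_map_roots_X_pow_mul_prod {ι : Type*} [Fintype ι] (s : ι → ℝ) (a : ℕ) (f : ℝ → ℝ) :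
    (((X ^ a * ∏ i, (X - C (s i)) : ℝ[X]).roots).map f).sum = a * f 0 + ∑ i, f (s i) := by
  have h0 : (∏ i, (X - C (s i)) : ℝ[X]) ≠ 0 :=
    Finset.prod_ne_zero_iff.2 fun i _ => X_sub_C_ne_zero _
  rw [roots_mul (mul_ne_zero (pow_ne_zero _ X_ne_zero) h0), roots_X_pow, roots_prod _ _ h0]
  simp [Multiset.map_nsmul, Multiset.sum_nsmul]

section LineGraph

variable {V : Type*} [Fintype V] [DecidableEq V] (G : SimpleGraph V) [DecidableRel G.Adj]

/-- The incidence matrix of `G`, with columns indexed by the edges of `G` only. -/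
def edgeIncMatrix : Matrix V G.edgeSet ℝ :=
  Matrix.of fun v e => if v ∈ (e : Sym2 V) then 1 else 0

theorem edgeIncMatrix_mul_transpose :
    edgeIncMatrix G * (edgeIncMatrix G).transpose =
      Matrix.of fun a b => if a = b then (G.degree a : ℝ) else if G.Adj a b then 1 else 0 := by
  rw [← G.incMatrix_mul_transpose]
  ext a b
  simp only [Matrix.mul_apply, Matrix.transpose_apply]
  symm
  rw [← Finset.sum_subset (Finset.subset_univ G.edgeFinset)]
  · rw [← Finset.sum_coe_sort]
    refine Fintype.sum_equiv (Equiv.subtypeEquivRight fun e => by simp) _ _ fun e => ?_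
    have he : (e : Sym2 V) ∈ G.edgeSet := SimpleGraph.mem_edgeFinset.1 e.2
    simp [edgeIncMatrix, SimpleGraph.incMatrix_apply', SimpleGraph.incidenceSet, he]
  · intro e _ he
    rw [SimpleGraph.mem_edgeFinset] at he
    simp [SimpleGraph.incMatrix_apply', SimpleGraph.incidenceSet, he]

theorem transpose_mul_edgeIncMatrix [DecidableRel G.lineGraph.Adj] :
    (edgeIncMatrix G).transpose * edgeIncMatrix G =
      G.lineGraph.adjMatrix ℝ + Matrix.scalar G.edgeSet 2 := by
  ext e f
  have h1 : ((edgeIncMatrix G).transpose * edgeIncMatrix G) e f =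
      ((Finset.univ.filter fun v => v ∈ (e : Sym2 V) ∧ v ∈ (f : Sym2 V)).card : ℝ) := by
    simp [Matrix.mul_apply, edgeIncMatrix, ← ite_and, Finset.sum_boole, and_comm]
  rw [h1]
  by_cases hef : e = f
  · subst hef
    obtain ⟨⟨a, b⟩, he⟩ := e
    have hab : a ≠ b := G.ne_of_adj he
    have : (Finset.univ.filter fun v => v ∈ s(a, b) ∧ v ∈ s(a, b)) = {a, b} := by
      ext; simp
    simp only [Matrix.add_apply, SimpleGraph.adjMatrix_apply, SimpleGraph.irrefl, if_false,
      Matrix.scalar_apply, Matrix.diagonal_apply_eq, zero_add]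
    erw [this, Finset.card_pair hab]
    norm_num
  · simp only [Matrix.add_apply, SimpleGraph.adjMatrix_apply, Matrix.scalar_apply,
      Matrix.diagonal_apply_ne _ hef, add_zero, SimpleGraph.lineGraph_adj_iff_exists]
    by_cases h : ∃ v, v ∈ (e : Sym2 V) ∧ v ∈ (f : Sym2 V)
    · obtain ⟨v, hv⟩ := h
      have : (Finset.univ.filter fun v => v ∈ (e : Sym2 V) ∧ v ∈ (f : Sym2 V)) = {v} := by
        ext w
        simp only [Finset.mem_filter, Finset.mem_univ, true_and, Finset.mem_singleton]
        refine ⟨fun hw => ?_, fun hw => hw ▸ hv⟩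
        by_contra hne
        exact hef (Subtype.ext (((Sym2.mem_and_mem_iff hne).1 ⟨hw.1, hv.1⟩).trans
          ((Sym2.mem_and_mem_iff hne).1 ⟨hw.2, hv.2⟩).symm))
      rw [this, if_pos ⟨hef, v, hv⟩]
      simp
    · rw [if_neg fun h' => h h'.2]
      push Not at h
      simpa [Finset.filter_eq_empty_iff] using h

open Polynomial in
/-- The energy of the line graph in terms of the roots `s` of the characteristic polynomial of the
signless Laplacian. -/
theorem graphEnergy_lineGraph_add (s : V → ℝ)
    (hs : (edgeIncMatrix G * (edgeIncMatrix G).transpose).charpoly = ∏ v, (X - C (s v))) :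
    graphEnergy G.lineGraph + 2 * Fintype.card V =
      ∑ v, |s v - 2| + 2 * G.edgeFinset.card := by
  classical
  have hH := G.lineGraph.isHermitian_adjMatrix ℝ
  have hen : graphEnergy G.lineGraph = ∑ e, |hH.eigenvalues e| := by
    unfold graphEnergy
    congr!
  have hcp : (edgeIncMatrix G).transpose * edgeIncMatrix G =
      G.lineGraph.adjMatrix ℝ - Matrix.scalar G.edgeSet (-2) := by
    rw [transpose_mul_edgeIncMatrix, map_neg, sub_neg_eq_add]
  have hcomm := Matrix.charpoly_mul_comm' (edgeIncMatrix G) (edgeIncMatrix G).transpose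
  have hB : ((edgeIncMatrix G).transpose * edgeIncMatrix G).charpoly =
      ∏ e, (X - C (hH.eigenvalues e + 2)) := by
    rw [hcp, Matrix.charpoly_sub_scalar, hH.charpoly_eq, prod_comp]
    refine Finset.prod_congr rfl fun e _ => ?_
    simp
    ring
  have hcard : G.edgeFinset.card = Fintype.card G.edgeSet := by
    rw [SimpleGraph.edgeFinset, Set.toFinset_card]
  have hcomm' : X ^ Fintype.card G.edgeSet * ∏ v, (X - C (s v)) =
      X ^ Fintype.card V * ∏ e, (X - C (hH.eigenvalues e + 2)) := by
    rw [← hB, ← hs, ← hcomm]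
  have := congrArg (fun p : ℝ[X] => (p.roots.map fun x => |x - 2|).sum) hcomm'
  simp only [sum_map_roots_X_pow_mul_prod, add_sub_cancel_right, zero_sub, abs_neg, abs_two] at this
  rw [hen, hcard]
  linarith

end LineGraph

open ArithmeticFunction in
/-- The sum of the primitive `m`-th roots of unity is `μ m`. -/
theorem sum_primitiveRoots_eq_moebius {m : ℕ} (hm : 0 < m) :
    ∑ ζ ∈ primitiveRoots m ℂ, ζ = (moebius m : ℂ) := by
  have h1 : ∀ n > 0, ∑ i ∈ n.divisors, ∑ ζ ∈ primitiveRoots i ℂ, ζ = if n = 1 then 1 else 0 := by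
    intro n hn
    obtain ⟨ζ, hζ⟩ : ∃ ζ : ℂ, IsPrimitiveRoot ζ n := ⟨_, Complex.isPrimitiveRoot_exp n hn.ne'⟩
    split_ifs with h
    · simp [h, IsPrimitiveRoot.primitiveRoots_one]
    rw [← Finset.sum_biUnion fun i _ j _ hij => IsPrimitiveRoot.disjoint hij,
      ← IsPrimitiveRoot.nthRoots_one_eq_biUnion_primitiveRoots]
    rw [← hζ.geom_sum_eq_zero (by omega)]
    symm
    refine Finset.sum_bij (fun i _ => ζ ^ i) ?_ ?_ ?_ fun _ _ => rfl
    · intro i _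
      rw [Polynomial.mem_nthRootsFinset hn, ← pow_mul, mul_comm, pow_mul, hζ.pow_eq_one, one_pow]
    · intro i hi j hj hij
      exact hζ.pow_inj (Finset.mem_range.1 hi) (Finset.mem_range.1 hj) hij
    · intro ξ hξ
      rw [Polynomial.mem_nthRootsFinset hn] at hξ
      have : NeZero n := ⟨hn.ne'⟩
      obtain ⟨i, hi, h⟩ := hζ.eq_pow_of_pow_eq_one hξ
      exact ⟨i, Finset.mem_range.2 hi, h⟩
  have h2 := sum_eq_iff_sum_mul_moebius_eq.1 h1 m hm
  rw [← h2, Nat.sum_divisorsAntidiagonal fun i j => (moebius i : ℂ) * if j = 1 then 1 else 0,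
    Finset.sum_eq_single m]
  · simp [hm]
  · intro d hd hne
    rw [Nat.mem_divisors] at hd
    have : m / d ≠ 1 := fun h => hne (Nat.eq_of_dvd_of_div_eq_one hd.1 h)
    simp [this]
  · simp [hm.ne']

theorem sum_units_pow_val_eq_moebius {m : ℕ} [NeZero m] {ξ : ℂ} (hξ : IsPrimitiveRoot ξ m) :
    ∑ v : (ZMod m)ˣ, ξ ^ (v : ZMod m).val = (ArithmeticFunction.moebius m : ℂ) := by
  have hm : 0 < m := Nat.pos_of_ne_zero (NeZero.ne m)
  rw [← sum_primitiveRoots_eq_moebius hm]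
  refine Finset.sum_bij (fun v _ => ξ ^ (v : ZMod m).val) ?_ ?_ ?_ fun _ _ => rfl
  · intro v _
    rw [mem_primitiveRoots hm]
    exact hξ.pow_of_coprime _ (ZMod.val_coe_unit_coprime v)
  · intro v _ w _ h
    exact Units.ext (ZMod.val_injective m (hξ.pow_inj (ZMod.val_lt _) (ZMod.val_lt _) h))
  · intro ζ hζ
    rw [mem_primitiveRoots hm, hξ.isPrimitiveRoot_iff] at hζ
    obtain ⟨i, hi, hc, rfl⟩ := hζ
    exact ⟨ZMod.unitOfCoprime i hc, Finset.mem_univ _, by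
      rw [ZMod.coe_unitOfCoprime, ZMod.val_natCast_of_lt hi]⟩

/-- Hölder's evaluation of Ramanujan sums. -/
theorem sum_units_pow_val {n m : ℕ} [NeZero n] (hmn : m ∣ n) {ξ : ℂ} (hξ : IsPrimitiveRoot ξ m) :
    ∑ u : (ZMod n)ˣ, ξ ^ (u : ZMod n).val =
      ((n.totient : ℝ) / m.totient * ArithmeticFunction.moebius m : ℝ) := by
  classical
  have : NeZero m := ⟨fun h => NeZero.ne n (zero_dvd_iff.1 (h ▸ hmn))⟩
  have hφ : (m.totient : ℂ) ≠ 0 := by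
    exact_mod_cast (Nat.totient_pos.2 (Nat.pos_of_ne_zero (NeZero.ne m))).ne'
  have hpow : ∀ u : (ZMod n)ˣ, ξ ^ (u : ZMod n).val =
      ξ ^ ((ZMod.unitsMap hmn u : (ZMod m)ˣ) : ZMod m).val := by
    intro u
    rw [ZMod.unitsMap_val, ZMod.cast_eq_val, ZMod.val_natCast]
    conv_lhs => rw [← pow_mod_orderOf, ← hξ.eq_orderOf]
  have hsurj := ZMod.unitsMap_surjective (m := n) hmn
  have hfib : ∀ v : (ZMod m)ˣ,
      (Finset.univ.filter fun u => ZMod.unitsMap hmn u = v).card =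
        (Finset.univ.filter fun u => ZMod.unitsMap hmn u = 1).card := fun v =>
    MonoidHom.card_fiber_eq_of_mem_range (ZMod.unitsMap hmn) (hsurj v) (hsurj 1)
  set c := (Finset.univ.filter fun u => ZMod.unitsMap hmn u = 1).card with hc
  have hcard : n.totient = m.totient * c := by
    have := Finset.card_eq_sum_card_fiberwise (f := ZMod.unitsMap hmn) (s := Finset.univ)
      (t := Finset.univ) fun _ _ => Finset.mem_coe.2 (Finset.mem_univ _)
    simpa [hfib, ZMod.card_units_eq_totient] using this
  simp_rw [hpow]
  rw [← Finset.sum_fiberwise Finset.univ (ZMod.unitsMap hmn)]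
  have : ∀ v : (ZMod m)ˣ, ∑ u with ZMod.unitsMap hmn u = v,
      ξ ^ ((ZMod.unitsMap hmn u : (ZMod m)ˣ) : ZMod m).val = c * ξ ^ (v : ZMod m).val := by
    intro v
    rw [Finset.sum_congr rfl fun u hu => by rw [(Finset.mem_filter.1 hu).2], Finset.sum_const,
      hfib, nsmul_eq_mul]
  simp_rw [this]
  rw [← Finset.mul_sum, sum_units_pow_val_eq_moebius hξ, hcard]
  push_cast
  field_simp

section

variable {n : ℕ} [NeZero n]

theorem isPrimitiveRoot_stdAddChar (k : ZMod n) :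
    IsPrimitiveRoot (ZMod.stdAddChar k : ℂ) (addOrderOf k) := by
  rw [IsPrimitiveRoot.iff_def]
  have h : ∀ l : ℕ, (ZMod.stdAddChar k : ℂ) ^ l = 1 ↔ l • k = 0 := by
    intro l
    rw [← AddChar.map_nsmul_eq_pow, ← (ZMod.stdAddChar (N := n)).map_zero_eq_one,
      ZMod.injective_stdAddChar.eq_iff]
  exact ⟨(h _).2 (addOrderOf_nsmul_eq_zero k),
    fun l hl => addOrderOf_dvd_of_nsmul_eq_zero ((h l).1 hl)⟩

theorem addOrderOf_dvd_zmod (k : ZMod n) : addOrderOf k ∣ n := by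
  simpa [ZMod.card] using addOrderOf_dvd_card (x := k)

theorem sum_units_stdAddChar (k : ZMod n) :
    ∑ u : (ZMod n)ˣ, (ZMod.stdAddChar ((u : ZMod n) * k) : ℂ) =
      ((n.totient : ℝ) / (addOrderOf k).totient *
        ArithmeticFunction.moebius (addOrderOf k) : ℝ) := by
  rw [← sum_units_pow_val (addOrderOf_dvd_zmod k) (isPrimitiveRoot_stdAddChar k)]
  refine Finset.sum_congr rfl fun u _ => ?_
  rw [← AddChar.map_nsmul_eq_pow, nsmul_eq_mul, ZMod.natCast_zmod_val]

variable [DecidableRel (unitaryCayleyGraph (ZMod n)).Adj]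

theorem unitaryCayleyGraph_sum_adj (hn : 2 ≤ n) {M : Type*} [AddCommMonoid M] (x : ZMod n)
    (f : ZMod n → M) :
    ∑ y, (if (unitaryCayleyGraph (ZMod n)).Adj x y then f y else 0) =
      ∑ u : (ZMod n)ˣ, f (x + u) := by
  have : Fact (1 < n) := ⟨hn⟩
  rw [← Finset.sum_filter]
  symm
  refine Finset.sum_bij (fun u _ => x + (u : ZMod n)) ?_ ?_ ?_ fun _ _ => rfl
  · intro u _
    simp [unitaryCayleyGraph_adj]
  · intro u _ v _ h
    exact Units.ext (add_left_cancel h)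
  · intro y hy
    rw [Finset.mem_filter, unitaryCayleyGraph_adj] at hy
    obtain ⟨u, hu⟩ := hy.2
    exact ⟨-u, Finset.mem_univ _, by simp [hu]⟩

theorem unitaryCayleyGraph_degree (hn : 2 ≤ n) (x : ZMod n) :
    (unitaryCayleyGraph (ZMod n)).degree x = n.totient := by
  have := unitaryCayleyGraph_sum_adj hn x fun _ => 1
  rw [Finset.sum_boole] at this
  rw [← SimpleGraph.card_neighborFinset_eq_degree, SimpleGraph.neighborFinset_eq_filter]
  simpa [ZMod.card_units_eq_totient] using this

open Polynomial in
/-- The signless Laplacian spectrum of the unitary Cayley graph of `ℤ/nℤ`. -/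
theorem charpoly_edgeIncMatrix_unitaryCayleyGraph (hn : 2 ≤ n) :
    (edgeIncMatrix (unitaryCayleyGraph (ZMod n)) *
      (edgeIncMatrix (unitaryCayleyGraph (ZMod n))).transpose).charpoly =
    ∏ k : ZMod n, (X - C ((n.totient : ℝ) + (n.totient : ℝ) / (addOrderOf k).totient *
        ArithmeticFunction.moebius (addOrderOf k))) := by
  set s : ZMod n → ℝ := fun k => (n.totient : ℝ) + (n.totient : ℝ) / (addOrderOf k).totient *
        ArithmeticFunction.moebius (addOrderOf k) with hs
  set M := edgeIncMatrix (unitaryCayleyGraph (ZMod n)) *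
      (edgeIncMatrix (unitaryCayleyGraph (ZMod n))).transpose with hM
  let F : Matrix (ZMod n) (ZMod n) ℂ := Matrix.of fun x k => ZMod.stdAddChar (x * k)
  let F' : Matrix (ZMod n) (ZMod n) ℂ := Matrix.of fun k x => (n : ℂ)⁻¹ * ZMod.stdAddChar (-(k * x))
  have hn0 : (n : ℂ) ≠ 0 := by exact_mod_cast NeZero.ne n
  have hFF : F * F' = 1 := by
    ext x y
    have h := AddChar.sum_mulShift (x - y) (ZMod.isPrimitive_stdAddChar n)
    rw [ZMod.card] at h
    have h2 : (F * F') x y = (n : ℂ)⁻¹ * ∑ k : ZMod n, (ZMod.stdAddChar (k * (x - y)) : ℂ) := by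
      rw [Matrix.mul_apply, Finset.mul_sum]
      refine Finset.sum_congr rfl fun k _ => ?_
      simp only [F, F', Matrix.of_apply]
      rw [mul_left_comm, ← AddChar.map_add_eq_mul]
      congr 2
      ring
    rw [h2, h, Matrix.one_apply]
    by_cases hxy : x = y <;> simp [hxy, sub_eq_zero, hn0]
  have hMF : M.map (algebraMap ℝ ℂ) * F = F * Matrix.diagonal fun k => (s k : ℂ) := by
    ext x k
    rw [Matrix.mul_diagonal, Matrix.mul_apply]
    have hterm : ∀ y, M.map (algebraMap ℝ ℂ) x y * F y k =
        (if x = y then (n.totient : ℂ) * ZMod.stdAddChar (y * k) else 0) +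
        (if (unitaryCayleyGraph (ZMod n)).Adj x y then ZMod.stdAddChar (y * k) else 0) := by
      intro y
      rw [Matrix.map_apply, hM, edgeIncMatrix_mul_transpose]
      by_cases hxy : x = y
      · subst hxy
        simp [F, unitaryCayleyGraph_degree hn]
      · by_cases h : (unitaryCayleyGraph (ZMod n)).Adj x y <;> simp [F, hxy, h]
    simp_rw [hterm]
    rw [Finset.sum_add_distrib, Finset.sum_ite_eq,
      unitaryCayleyGraph_sum_adj hn x fun y => (ZMod.stdAddChar (y * k) : ℂ)]
    simp_rw [add_mul, AddChar.map_add_eq_mul]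
    rw [← Finset.mul_sum, sum_units_stdAddChar]
    simp [F, hs]
    ring
  have hcp : (M.map (algebraMap ℝ ℂ)).charpoly = ∏ k, (X - C (s k : ℂ)) := by
    have h1 : M.map (algebraMap ℝ ℂ) = F * (Matrix.diagonal (fun k => (s k : ℂ)) * F') := by
      rw [← mul_assoc, ← hMF, mul_assoc, hFF, mul_one]
    rw [h1, Matrix.charpoly_mul_comm, mul_assoc, mul_eq_one_comm.1 hFF, mul_one,
      Matrix.charpoly_diagonal]
  rw [Matrix.charpoly_map] at hcp
  refine map_injective (algebraMap ℝ ℂ) (algebraMap ℝ ℂ).injective ?_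
  rw [hcp, Polynomial.map_prod]
  refine Finset.prod_congr rfl fun k _ => ?_
  rw [Polynomial.map_sub, map_X, map_C]
  rfl

end

section

open ArithmeticFunction

theorem sum_divisors_moebius_eq_zero {n : ℕ} (hn : 2 ≤ n) :
    ∑ m ∈ n.divisors, (moebius m : ℝ) = 0 := by
  have h := congrArg (fun f : ArithmeticFunction ℤ => f n) moebius_mul_coe_zeta
  rw [mul_comm, coe_zeta_mul_apply, one_apply] at h
  rw [if_neg (by omega)] at h
  exact_mod_cast h

theorem dvd_twelve_of_totient_eq_two {n : ℕ} (h : n.totient = 2) : n ∣ 12 := by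
  rw [Nat.dvd_iff_prime_pow_dvd_dvd]
  intro p k hp hk
  have hd := h ▸ Nat.totient_dvd_of_dvd hk
  rcases Nat.eq_zero_or_pos k with rfl | hk0
  · simp
  rw [Nat.totient_prime_pow hp hk0] at hd
  have hp3 : p - 1 ≤ 2 := Nat.le_of_dvd two_pos ((dvd_mul_left _ _).trans hd)
  have hpk : p ^ (k - 1) ≤ 2 := Nat.le_of_dvd two_pos ((dvd_mul_right _ _).trans hd)
  have hp2 := hp.two_le
  have hk2 : k - 1 < 2 := by
    by_contra! hc
    have := Nat.pow_le_pow_right hp.pos hc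
    have := Nat.pow_le_pow_left hp2 2
    omega
  have hp4 : p ≤ 3 := by omega
  have hk3 : k ≤ 2 := by omega
  interval_cases p <;> interval_cases k <;> revert hd <;> decide

theorem two_le_totient {n : ℕ} (hn : 2 < n) : 2 ≤ n.totient :=
  Nat.le_of_dvd (Nat.totient_pos.2 (by omega)) (Nat.totient_even hn).two_dvd

/-- Apart from `n = 3` and `n = 6`, the only eigenvalue of the line graph of the unitary Cayley
graph of `ℤ/nℤ` that can be negative, besides those coming from the cycle space, is the one
attached to the element of order two. -/
theorem unitaryCayleyGraph_eigenvalue_nonneg {n m : ℕ} (hn : 2 ≤ n) (h3 : n ≠ 3) (h6 : n ≠ 6)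
    (hm : m ∣ n) (hm2 : m ≠ 2) :
    0 ≤ (n.totient : ℝ) + (n.totient : ℝ) / m.totient * moebius m - 2 := by
  obtain ⟨c, hc⟩ := Nat.totient_dvd_of_dvd hm
  have hm0 : 0 < m := Nat.pos_of_dvd_of_pos hm (by omega)
  have hφm : 0 < m.totient := Nat.totient_pos.2 hm0
  have hφn : 0 < n.totient := Nat.totient_pos.2 (by omega)
  have hc0 : 0 < c := Nat.pos_of_mul_pos_left (hc ▸ hφn)
  have hdiv : (n.totient : ℝ) / m.totient = c := by
    rw [hc]
    push_cast
    field_simp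
  rw [hdiv]
  have key : (2 : ℤ) ≤ n.totient + c * moebius m := by
    rcases eq_or_ne m 1 with rfl | hm1
    · simp at hc
      simp
      omega
    have hm3 : 2 < m := by omega
    have hn3 : 2 < n := lt_of_lt_of_le hm3 (Nat.le_of_dvd (by omega) hm)
    have h2n := two_le_totient hn3
    have h2m := two_le_totient hm3
    rcases Int.abs_le_one_iff.1 (abs_moebius_le_one (n := m)) with h | h | h
    · rw [h]; omega
    · rw [h]; omega
    rw [h]
    by_cases h4 : n.totient = 2
    · have hd := dvd_twelve_of_totient_eq_two h4
      have hle := Nat.le_of_dvd (by norm_num) hd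
      have hn4 : n = 4 := by
        interval_cases n <;> first | rfl | omega | (revert h4; decide)
      subst hn4
      have hle := Nat.le_of_dvd (by norm_num) hm
      have : m = 4 := by
        interval_cases m
        · revert hm; decide
        · rfl
      subst this
      rw [moebius_eq_zero_of_not_squarefree (by decide)] at h
      omega
    · have : c * 2 ≤ n.totient := by
        rw [hc, mul_comm]
        exact Nat.mul_le_mul_right _ h2m
      obtain ⟨t, ht⟩ := Nat.totient_even hn3
      omega
  have : (2 : ℝ) ≤ n.totient + c * moebius m := by exact_mod_cast key
  linarith

theorem sum_zmod_addOrderOf {n : ℕ} [NeZero n] (f : ℕ → ℝ) :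
    ∑ k : ZMod n, f (addOrderOf k) = ∑ m ∈ n.divisors, m.totient * f m := by
  classical
  rw [← Finset.sum_fiberwise_of_maps_to (s := Finset.univ) (t := n.divisors)
    (g := fun k : ZMod n => addOrderOf k)
    fun k _ => Nat.mem_divisors.2 ⟨addOrderOf_dvd_zmod k, NeZero.ne n⟩]
  refine Finset.sum_congr rfl fun m hm => ?_
  rw [Finset.sum_congr rfl fun k hk => by rw [(Finset.mem_filter.1 hk).2], Finset.sum_const,
    nsmul_eq_mul, IsAddCyclic.card_addOrderOf_eq_totient]
  rw [ZMod.card]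
  exact (Nat.mem_divisors.1 hm).1

/-- The energy of the line graph of the unitary Cayley graph of `ℤ/nℤ` as a sum over the divisors
of `n`. -/
theorem graphEnergy_lineGraph_unitaryCayleyGraph {n : ℕ} [NeZero n] (hn : 2 ≤ n) :
    graphEnergy (unitaryCayleyGraph (ZMod n)).lineGraph =
      ∑ m ∈ n.divisors, m.totient *
        |(n.totient : ℝ) + (n.totient : ℝ) / m.totient * moebius m - 2| +
      n * ((n.totient : ℝ) - 2) := by
  classical
  have h := graphEnergy_lineGraph_add _ _ (charpoly_edgeIncMatrix_unitaryCayleyGraph hn)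
  rw [sum_zmod_addOrderOf fun m =>
    |(n.totient : ℝ) + (n.totient : ℝ) / m.totient * moebius m - 2|, ZMod.card] at h
  have he := (unitaryCayleyGraph (ZMod n)).sum_degrees_eq_twice_card_edges
  simp only [unitaryCayleyGraph_degree hn, Finset.sum_const, Finset.card_univ, ZMod.card,
    smul_eq_mul] at he
  have he' : (n : ℝ) * n.totient =
      2 * (unitaryCayleyGraph (ZMod n)).edgeFinset.card := by exact_mod_cast he
  linarith

theorem graphEnergy_lineGraph_unitaryCayleyGraph_generic {n : ℕ} [NeZero n] (hn : 2 ≤ n)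
    (h3 : n ≠ 3) (h6 : n ≠ 6) :
    graphEnergy (unitaryCayleyGraph (ZMod n)).lineGraph =
      (if 2 ∣ n then 4 else 0) + 2 * n * ((n.totient : ℝ) - 2) := by
  rw [graphEnergy_lineGraph_unitaryCayleyGraph hn]
  have hterm : ∀ m ∈ n.divisors,
      (m.totient : ℝ) * |(n.totient : ℝ) + (n.totient : ℝ) / m.totient * moebius m - 2| =
        m.totient * ((n.totient : ℝ) - 2) + n.totient * moebius m + if m = 2 then 4 else 0 := by
    intro m hm
    have hm0 : 0 < m := Nat.pos_of_mem_divisors hm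
    have hφ : (m.totient : ℝ) ≠ 0 := by exact_mod_cast (Nat.totient_pos.2 hm0).ne'
    by_cases h2 : m = 2
    · subst h2
      rw [moebius_apply_prime Nat.prime_two, Nat.totient_two]
      norm_num
      ring
    · rw [abs_of_nonneg (unitaryCayleyGraph_eigenvalue_nonneg hn h3 h6
        (Nat.mem_divisors.1 hm).1 h2), if_neg h2]
      field_simp
      ring
  have hsum : ∑ m ∈ n.divisors, (m.totient : ℝ) = n := by exact_mod_cast Nat.sum_totient n
  rw [Finset.sum_congr rfl hterm, Finset.sum_add_distrib, Finset.sum_add_distrib,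
    ← Finset.sum_mul, ← Finset.mul_sum, sum_divisors_moebius_eq_zero hn, hsum,
    Finset.sum_ite_eq']
  simp only [Nat.mem_divisors, NeZero.ne n, ne_eq, not_false_eq_true, and_true]
  ring

theorem graphEnergy_lineGraph_unitaryCayleyGraph_three :
    graphEnergy (unitaryCayleyGraph (ZMod 3)).lineGraph = 4 := by
  rw [graphEnergy_lineGraph_unitaryCayleyGraph (by norm_num), Nat.prime_three.divisors]
  rw [Finset.sum_pair (by norm_num), moebius_apply_prime Nat.prime_three,
    Nat.totient_prime Nat.prime_three]
  norm_num

theorem graphEnergy_lineGraph_unitaryCayleyGraph_six :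
    graphEnergy (unitaryCayleyGraph (ZMod 6)).lineGraph = 8 := by
  have hd : Nat.divisors 6 = {1, 2, 3, 6} := by decide
  have h6 : Nat.totient 6 = 2 := by decide
  have hμ : moebius 6 = 1 := by
    rw [show 6 = 2 * 3 by norm_num, isMultiplicative_moebius.map_mul_of_coprime (by norm_num),
      moebius_apply_prime Nat.prime_two, moebius_apply_prime Nat.prime_three]
    norm_num
  rw [graphEnergy_lineGraph_unitaryCayleyGraph (by norm_num), hd]
  rw [Finset.sum_insert (by decide), Finset.sum_insert (by decide), Finset.sum_pair (by decide),
    moebius_apply_prime Nat.prime_three, moebius_apply_prime Nat.prime_two, hμ, h6,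
    Nat.totient_prime Nat.prime_three, Nat.totient_two]
  norm_num

end

theorem corollary5p2 (n : ℕ) [NeZero n] (hn : 2 ≤ n) :
    (n = 3 → graphEnergy (unitaryCayleyGraph (ZMod n)).lineGraph = 4) ∧
    (n = 6 → graphEnergy (unitaryCayleyGraph (ZMod n)).lineGraph = 8) ∧
    (∀ a : ℕ, 1 ≤ a → n = 2 ^ a →
      graphEnergy (unitaryCayleyGraph (ZMod n)).lineGraph = 4 * ((2 : ℝ) ^ (a - 1) - 1) ^ 2) ∧
    (Even n → n ≠ 6 →
      graphEnergy (unitaryCayleyGraph (ZMod n)).lineGraph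
        = 4 + 2 * (n : ℝ) * ((Nat.totient n : ℝ) - 2)) ∧
    (Odd n → n ≠ 3 →
      graphEnergy (unitaryCayleyGraph (ZMod n)).lineGraph
        = 2 * (n : ℝ) * ((Nat.totient n : ℝ) - 2)) := by
  have heven : Even n → n ≠ 6 → graphEnergy (unitaryCayleyGraph (ZMod n)).lineGraph
      = 4 + 2 * (n : ℝ) * ((Nat.totient n : ℝ) - 2) := by
    intro he h6
    rw [graphEnergy_lineGraph_unitaryCayleyGraph_generic hn (by rintro rfl; revert he; decide) h6,
      if_pos he.two_dvd]
  refine ⟨?_, ?_, ?_, heven, ?_⟩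
  · rintro rfl
    exact graphEnergy_lineGraph_unitaryCayleyGraph_three
  · rintro rfl
    exact graphEnergy_lineGraph_unitaryCayleyGraph_six
  · intro a ha hna
    obtain ⟨b, rfl⟩ := Nat.exists_eq_add_of_le' ha
    have h6 : n ≠ 6 := by
      rintro rfl
      have h3 : 3 ∣ 2 ^ (b + 1) := hna ▸ by decide
      exact absurd (Nat.prime_three.dvd_of_dvd_pow h3) (by decide)
    have he : Even n := hna ▸ (even_two.pow_of_ne_zero b.succ_ne_zero)
    rw [heven he h6, hna, Nat.totient_prime_pow_succ Nat.prime_two]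
    push_cast
    ring
  · intro ho h3
    have h2 : ¬ 2 ∣ n := ho.not_two_dvd_nat
    rw [graphEnergy_lineGraph_unitaryCayleyGraph_generic hn h3
      (by rintro rfl; exact h2 (by decide)), if_neg h2, zero_add]
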